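/- Let $V$ be a complex vector space of dimension $2$ and let $W < \mathrm{GL}(V)$ be a finite group generated by pseudo-reflections, i.e. by elements of finite order whose fixed points form a hyperplane of $V$. Assume that $W$ acts irreducibly on $V$. Let $R(W)$ be the representation ring of $W$: the free abelian group on the isomorphism classes $[A]$ of finite-dimensional complex representations of $W$, modulo the relations $[A \oplus B] = [A] + [B]$, with multiplication $[A]\cdot[B] = [A \otimes B]$. Then $R(W)$ is generated, as a ring, by the class $[V]$ of the reflection representation and the classes of the $1$-dimensional representations of $W$. -/

import Mathlib

open CategoryTheory

noncomputable section

/-- A pseudo-reflection of a complex vector space `V`: an invertible endomorphism of finite order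
whose fixed points form a hyperplane (so it is not the identity). -/
def IsPseudoReflection {V : Type*} [AddCommGroup V] [Module ℂ V] (g : V ≃ₗ[ℂ] V) : Prop :=
  IsOfFinOrder g ∧
    Module.finrank ℂ (LinearMap.fixedSubmodule (g : V →ₗ[ℂ] V)) + 1 = Module.finrank ℂ V

/-- A (complex) reflection group: a finite subgroup of `GL(V)` generated by the pseudo-reflections
it contains. -/
structure IsReflectionGroup {V : Type*} [AddCommGroup V] [Module ℂ V]
    (W : Subgroup (V ≃ₗ[ℂ] V)) : Prop where
  finite : Finite W
  closure_eq : Subgroup.closure {g : V ≃ₗ[ℂ] V | g ∈ W ∧ IsPseudoReflection g} = W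

/-- The tautological representation of `W < GL(V)` on `V`: the reflection representation. -/
def reflectionRep {V : Type*} [AddCommGroup V] [Module ℂ V] (W : Subgroup (V ≃ₗ[ℂ] V)) :
    Representation ℂ W V :=
  LinearEquiv.automorphismGroup.toLinearMapMonoidHom.comp W.subtype

/-- Isomorphism classes of finite-dimensional complex representations of `G`. They form a
commutative monoid, the product being the tensor product and the unit the trivial representation. -/
abbrev RepIsoClass (G : Type*) [Group G] : Type _ := Skeleton (FDRep ℂ G)

/-- The ideal of relations `[A ⊕ B] = [A] + [B]` in the monoid ring of the isomorphism classes. As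
tensor products distribute over direct sums, it is also the additive subgroup that these relations
generate. -/
def directSumRelations (G : Type*) [Group G] : Ideal (MonoidAlgebra ℤ (RepIsoClass G)) :=
  Ideal.span {x | ∃ A B : FDRep ℂ G,
    x = MonoidAlgebra.of ℤ (RepIsoClass G) (toSkeleton (FDRep.of (Representation.prod A.ρ B.ρ)))
      - MonoidAlgebra.of ℤ (RepIsoClass G) (toSkeleton A)
      - MonoidAlgebra.of ℤ (RepIsoClass G) (toSkeleton B)}

/-- The representation ring `R(G)`: the Grothendieck ring of the finite-dimensional complex
representations of `G`, i.e. the free abelian group on the isomorphism classes modulo the relations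
`[A ⊕ B] = [A] + [B]`, with multiplication `[A] * [B] = [A ⊗ B]`. -/
abbrev RepRing (G : Type*) [Group G] : Type _ :=
  MonoidAlgebra ℤ (RepIsoClass G) ⧸ directSumRelations G

/-- The class `[A]` of a representation `A` in the representation ring. -/
def repClass {G : Type*} [Group G] (A : FDRep ℂ G) : RepRing G :=
  Ideal.Quotient.mk (directSumRelations G)
    (MonoidAlgebra.of ℤ (RepIsoClass G) (toSkeleton A))

end

open CategoryTheory

noncomputable section

/-! The argument works for a finite group `G` acting faithfully on `ℂ²`. Let `S` be the ring of
binary forms, `S_n` its part of degree `n` (the `n`-th symmetric power), and `R'` the subring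
generated by `[V]` and the linear characters (`charSubring`). The Koszul complex gives `[V][S_{n+1}]
= [det][S_n] + [S_{n+2}]` (`koszul_repCls`), so every `[S_n]` lies in `R'`. As `[det]` is a unit,
the same recursion runs downwards: `[A]` lies in `R'` once `[S_n][A]` does for all large `n`.

For large `n`, interpolation at a point with trivial stabilizer embeds `S ⊗ A` equivariantly into a
finite sum of shifts of `S`. Filtering by successive kernels leaves stable graded ideals of `S`
(`eventually_subCls_mem_of_maps`). In large degrees such an ideal is `f · S`
(`exists_eventually_eq_map_mulLeft`); stability makes `f` a semi-invariant with some character `χ`,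
so the class is `[χ][S_k]`, which lies in `R'` (`eventually_subCls_mem`). -/

open MonoidalCategory in
theorem repClass_eq_of_iso {G : Type*} [Group G] {A B : FDRep ℂ G} (e : A ≅ B) :
    repClass A = repClass B := by
  have h : toSkeleton A = toSkeleton B := Quotient.sound ⟨e⟩
  rw [repClass, repClass, h]

/-! ### Classes of representations: additivity, twists, characters -/

section RepCls

variable {G : Type*} [Group G]

/-- The class in the representation ring of an unbundled finite-dimensional representation. -/
def repCls {X : Type} [AddCommGroup X] [Module ℂ X] [FiniteDimensional ℂ X]
    (ρ : Representation ℂ G X) : RepRing G := repClass (FDRep.of ρ)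

variable {X Y Z : Type} [AddCommGroup X] [AddCommGroup Y] [AddCommGroup Z]
  [Module ℂ X] [Module ℂ Y] [Module ℂ Z]

theorem repCls_congr [FiniteDimensional ℂ X] [FiniteDimensional ℂ Y]
    {ρ : Representation ℂ G X} {σ : Representation ℂ G Y}
    (e : X ≃ₗ[ℂ] Y) (he : ∀ g x, e (ρ g x) = σ g (e x)) : repCls ρ = repCls σ := by
  refine repClass_eq_of_iso (Action.mkIso (LinearEquiv.toFGModuleCatIso e) (fun g => ?_))
  ext x
  exact he g x

open MonoidalCategory in
theorem repCls_tprod [FiniteDimensional ℂ X] [FiniteDimensional ℂ Y]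
    (ρ : Representation ℂ G X) (σ : Representation ℂ G Y) :
    repCls (ρ.tprod σ) = repCls ρ * repCls σ := by
  have e : (FDRep.of ρ ⊗ FDRep.of σ : FDRep ℂ G) ≅ FDRep.of (ρ.tprod σ) := by
    refine Action.mkIso (Iso.refl _) (fun g => ?_)
    ext : 1
    rfl
  rw [repCls, ← repClass_eq_of_iso e, repClass, Skeleton.toSkeleton_tensorObj, map_mul, map_mul]
  rfl

open MonoidalCategory in
theorem repCls_trivial : repCls (Representation.trivial ℂ G ℂ) = 1 := by
  have e : (𝟙_ (FDRep ℂ G) : FDRep ℂ G) ≅ FDRep.of (Representation.trivial ℂ G ℂ) := by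
    refine Action.mkIso (Iso.refl _) (fun g => ?_)
    ext : 1
    rfl
  rw [repCls, ← repClass_eq_of_iso e, repClass, ← Skeleton.one_eq, map_one, map_one]

theorem repCls_prod [FiniteDimensional ℂ X] [FiniteDimensional ℂ Y]
    (ρ : Representation ℂ G X) (σ : Representation ℂ G Y) :
    repCls (ρ.prod σ) = repCls ρ + repCls σ := by
  have h := Ideal.Quotient.eq_zero_iff_mem.mpr
    (Ideal.subset_span (α := MonoidAlgebra ℤ (RepIsoClass G))
      ⟨FDRep.of ρ, FDRep.of σ, rfl⟩ : _ ∈ directSumRelations G)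
  rw [map_sub, map_sub, sub_sub, sub_eq_zero] at h
  exact h

theorem repCls_eq_zero [FiniteDimensional ℂ X] [Subsingleton X] (ρ : Representation ℂ G X) :
    repCls ρ = 0 := by
  have h : repCls (ρ.prod ρ) = repCls ρ :=
    repCls_congr { toFun := fun x => x.1, invFun := fun x => (x, x), map_add' := fun _ _ => rfl,
                   map_smul' := fun _ _ => rfl, left_inv := fun _ => Subsingleton.elim _ _,
                   right_inv := fun _ => rfl } (fun _ _ => rfl)
  rw [repCls_prod] at h
  simpa using h

/-- Classes are additive in short exact sequences. -/
theorem repCls_exact [Finite G] [FiniteDimensional ℂ X] [FiniteDimensional ℂ Y]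
    [FiniteDimensional ℂ Z]
    {ρ : Representation ℂ G X} {σ : Representation ℂ G Y} {τ : Representation ℂ G Z}
    (i : X →ₗ[ℂ] Y) (f : Y →ₗ[ℂ] Z) (hi : ∀ g x, i (ρ g x) = σ g (i x))
    (hf : ∀ g y, f (σ g y) = τ g (f y)) (hinj : Function.Injective i)
    (hsurj : Function.Surjective f) (hex : ∀ y, f y = 0 ↔ y ∈ LinearMap.range i) :
    repCls σ = repCls ρ + repCls τ := by
  have := Fintype.ofFinite G
  obtain ⟨p, hp⟩ := LinearMap.exists_leftInverse_of_injective i (LinearMap.ker_eq_bot.mpr hinj)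
  have hp' : ∀ x, p (i x) = x := fun x => LinearMap.congr_fun hp x
  -- Maschke: averaging a linear retraction of `i` makes it equivariant, and `(q, f)` then splits
  -- the sequence.
  let q : Y →ₗ[ℂ] X := (Fintype.card G : ℂ)⁻¹ • ∑ g : G, ρ g ∘ₗ p ∘ₗ σ g⁻¹
  have hqapp : ∀ y, q y = (Fintype.card G : ℂ)⁻¹ • ∑ g : G, ρ g (p (σ g⁻¹ y)) := by
    intro y; simp [q]
  have hq : ∀ x, q (i x) = x := by
    intro x
    have : ∀ g : G, ρ g (p (σ g⁻¹ (i x))) = x := fun g => by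
      rw [← hi, hp', ← Module.End.mul_apply, ← map_mul, mul_inv_cancel, map_one,
        Module.End.one_apply]
    rw [hqapp]
    simp only [this, Finset.sum_const, Finset.card_univ]
    rw [← Nat.cast_smul_eq_nsmul ℂ, smul_smul, inv_mul_cancel₀, one_smul]
    exact Nat.cast_ne_zero.mpr Fintype.card_ne_zero
  have hqe : ∀ h y, q (σ h y) = ρ h (q y) := by
    intro h y
    rw [hqapp, hqapp, map_smul, map_sum]
    congr 1
    rw [← Equiv.sum_comp (Equiv.mulLeft h)]
    refine Finset.sum_congr rfl fun g _ => ?_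
    simp only [Equiv.coe_mulLeft, ← Module.End.mul_apply, ← map_mul, mul_inv_rev]
    rw [inv_mul_cancel_right, map_mul, Module.End.mul_apply]
  rw [← repCls_prod]
  refine repCls_congr (LinearEquiv.ofBijective (q.prod f) ⟨?_, ?_⟩) ?_
  · rw [← LinearMap.ker_eq_bot, LinearMap.ker_eq_bot']
    intro y hy
    obtain ⟨h1, h2⟩ := Prod.mk.inj hy
    obtain ⟨x, rfl⟩ := (hex y).mp h2
    rw [← hq x, show q (i x) = 0 from h1, map_zero]
  · rintro ⟨x, z⟩
    obtain ⟨y, rfl⟩ := hsurj z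
    refine ⟨y + i (x - q y), ?_⟩
    have h0 : f (i (x - q y)) = 0 := (hex _).mpr ⟨_, rfl⟩
    refine Prod.ext (by simp [hq]) ?_
    change f (y + i (x - q y)) = f y
    rw [map_add, h0, add_zero]
  · intro g y
    exact Prod.ext (hqe g y) (hf g y)

/-- The class of a finite-dimensional stable subspace of a representation. -/
def subCls (ρ : Representation ℂ G X) (U : Submodule ℂ X) [FiniteDimensional ℂ U]
    (hU : ∀ g, U ≤ U.comap (ρ g)) : RepRing G := repCls (ρ.subrepresentation U hU)

/-- Rank–nullity for classes; it peels off one map at a time when a module is filtered by kernels.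
-/
theorem subCls_eq_inf_ker_add_map [Finite G] (ρ : Representation ℂ G X) (σ : Representation ℂ G Y)
    (f : X →ₗ[ℂ] Y) (hf : ∀ g x, f (ρ g x) = σ g (f x)) (U : Submodule ℂ X)
    [FiniteDimensional ℂ U] (hU : ∀ g, U ≤ U.comap (ρ g))
    (hK : ∀ g, U ⊓ LinearMap.ker f ≤ (U ⊓ LinearMap.ker f).comap (ρ g))
    (hI : ∀ g, U.map f ≤ (U.map f).comap (σ g)) :
    subCls ρ U hU = subCls ρ (U ⊓ LinearMap.ker f) hK + subCls σ (U.map f) hI := by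
  refine repCls_exact (Submodule.inclusion inf_le_left)
    (f.restrict (p := U) (q := U.map f) fun x hx => Submodule.mem_map_of_mem hx) ?_ ?_ ?_ ?_ ?_
  · intro g x; rfl
  · intro g y; exact Subtype.ext (hf g y)
  · exact Submodule.inclusion_injective _
  · rintro ⟨_, y, hy, rfl⟩
    exact ⟨⟨y, hy⟩, rfl⟩
  · rintro ⟨y, hy⟩
    constructor
    · intro h
      exact ⟨⟨y, hy, Subtype.ext_iff.mp h⟩, rfl⟩
    · rintro ⟨⟨z, hz1, hz2⟩, hz⟩
      obtain rfl : z = y := Subtype.ext_iff.mp hz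
      exact Subtype.ext hz2

/-- The twist of a representation by a linear character. -/
def twistRep (χ : G →* ℂ) (ρ : Representation ℂ G X) : Representation ℂ G X where
  toFun g := χ g • ρ g
  map_one' := by simp
  map_mul' g h := by
    rw [map_mul, map_mul, smul_mul_smul_comm]

theorem twistRep_apply (χ : G →* ℂ) (ρ : Representation ℂ G X) (g : G) (x : X) :
    twistRep χ ρ g x = χ g • ρ g x := rfl

/-- The one-dimensional representation given by a linear character. -/
def charRep (χ : G →* ℂ) : Representation ℂ G ℂ := twistRep χ (Representation.trivial ℂ G ℂ)

theorem charRep_apply (χ : G →* ℂ) (g : G) (z : ℂ) : charRep χ g z = χ g * z := rfl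

theorem repCls_twistRep [FiniteDimensional ℂ X] (χ : G →* ℂ) (ρ : Representation ℂ G X) :
    repCls (twistRep χ ρ) = repCls (charRep χ) * repCls ρ := by
  rw [← repCls_tprod]
  refine (repCls_congr (TensorProduct.lid ℂ X) ?_).symm
  intro g t
  induction t with
  | zero => simp
  | add a b ha hb => simp only [map_add, ha, hb]
  | tmul z x =>
    simp [Representation.tprod_apply, charRep_apply, twistRep, smul_smul, mul_comm]

theorem repCls_charRep_mul (χ ψ : G →* ℂ) :
    repCls (charRep χ) * repCls (charRep ψ) = repCls (charRep (χ * ψ)) := by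
  rw [← repCls_twistRep]
  refine repCls_congr (LinearEquiv.refl ℂ ℂ) fun g z => ?_
  simp [twistRep, charRep_apply, mul_assoc]

theorem repCls_charRep_one : repCls (charRep (1 : G →* ℂ)) = 1 := by
  rw [← repCls_trivial]
  refine repCls_congr (LinearEquiv.refl ℂ ℂ) fun g z => ?_
  simp [charRep_apply]

end RepCls

/-! ### Symmetric powers as binary forms, and the Koszul relation -/

section PolyRep

open MvPolynomial

/-- Polynomials in two variables. -/
abbrev BinPoly : Type := MvPolynomial (Fin 2) ℂ

variable {G : Type*} [Group G] (π : G →* Matrix (Fin 2) (Fin 2) ℂ)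

/-- The linear form with the given coefficients. -/
def linForm : (Fin 2 → ℂ) →ₗ[ℂ] BinPoly := Fintype.linearCombination ℂ (fun i => (X i : BinPoly))

theorem linForm_apply (v : Fin 2 → ℂ) : linForm v = v 0 • X 0 + v 1 • X 1 := by
  simp [linForm, Fintype.linearCombination_apply]

theorem linForm_single (i : Fin 2) : linForm (Pi.single i 1) = X i := by
  simp [linForm, Fintype.linearCombination_apply, Pi.single_apply]

theorem isHomogeneous_linForm (v : Fin 2 → ℂ) : (linForm v).IsHomogeneous 1 := by
  rw [linForm_apply, smul_eq_C_mul, smul_eq_C_mul]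
  exact (isHomogeneous_C_mul_X _ _).add (isHomogeneous_C_mul_X _ _)

/-- The linear substitution given by a matrix. -/
def linSubst (M : Matrix (Fin 2) (Fin 2) ℂ) : BinPoly →ₐ[ℂ] BinPoly :=
  aeval fun j => linForm (M.col j)

theorem linSubst_X (M : Matrix (Fin 2) (Fin 2) ℂ) (j : Fin 2) :
    linSubst M (X j) = linForm (M.col j) := by simp [linSubst]

theorem linSubst_linForm (M : Matrix (Fin 2) (Fin 2) ℂ) (v : Fin 2 → ℂ) :
    linSubst M (linForm v) = linForm (M.mulVec v) := by
  simp only [linForm_apply, map_add, map_smul, linSubst_X, Matrix.mulVec, Matrix.col, dotProduct,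
    Fin.sum_univ_two, Matrix.transpose_apply]
  module

theorem linSubst_one : linSubst 1 = AlgHom.id ℂ BinPoly := by
  refine algHom_ext fun i => ?_
  rw [linSubst_X, AlgHom.id_apply, ← linForm_single]
  congr 1
  ext j
  simp [Matrix.col, Matrix.one_apply, Pi.single_apply]

theorem linSubst_mul (M N : Matrix (Fin 2) (Fin 2) ℂ) :
    linSubst (M * N) = (linSubst M).comp (linSubst N) := by
  refine algHom_ext fun i => ?_
  rw [AlgHom.comp_apply, linSubst_X, linSubst_X, linSubst_linForm]
  rfl

theorem isHomogeneous_linSubst (M : Matrix (Fin 2) (Fin 2) ℂ) {p : BinPoly} {n : ℕ}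
    (hp : p.IsHomogeneous n) : (linSubst M p).IsHomogeneous n := by
  have := hp.aeval (fun j => linForm (M.col j)) (fun j => isHomogeneous_linForm _)
  rwa [one_mul] at this

/-- The action of `G` on binary polynomials by linear substitutions. -/
def polyRep : Representation ℂ G BinPoly where
  toFun g := (linSubst (π g)).toLinearMap
  map_one' := by rw [map_one, linSubst_one]; rfl
  map_mul' g h := by rw [map_mul, linSubst_mul]; rfl

theorem polyRep_apply (g : G) (p : BinPoly) : polyRep π g p = linSubst (π g) p := rfl

theorem polyRep_mul (g : G) (p q : BinPoly) :
    polyRep π g (p * q) = polyRep π g p * polyRep π g q := map_mul (linSubst (π g)) p q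

/-- Binary forms of degree `n`. -/
abbrev binForms (n : ℕ) : Submodule ℂ BinPoly := homogeneousSubmodule (Fin 2) ℂ n

instance (n : ℕ) : FiniteDimensional ℂ (binForms n) :=
  Module.Finite.of_fg (homogeneousSubmodule_fg _ _ n)

theorem binForms_stable (n : ℕ) (g : G) : binForms n ≤ (binForms n).comap (polyRep π g) :=
  fun _ hp => isHomogeneous_linSubst _ hp

/-- The symmetric powers of the standard representation. -/
def symRep (n : ℕ) : Representation ℂ G (binForms n) :=
  (polyRep π).subrepresentation (binForms n) (binForms_stable π n)

theorem symRep_coe (n : ℕ) (g : G) (p : binForms n) :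
    (symRep π n g p : BinPoly) = linSubst (π g) p.1 := rfl

/-- The standard representation on column vectors. -/
def stdRep : Representation ℂ G (Fin 2 → ℂ) :=
  (Matrix.toLinAlgEquiv' : _ ≃ₐ[ℂ] _).toMonoidHom.comp π

theorem stdRep_apply (g : G) (v : Fin 2 → ℂ) : stdRep π g v = (π g).mulVec v := rfl

/-- The determinant character. -/
def detChar : G →* ℂ := Matrix.detMonoidHom.comp π

theorem detChar_apply (g : G) : detChar π g = (π g).det := rfl

theorem repCls_symRep_zero : repCls (symRep π 0) = 1 := by
  rw [← repCls_trivial]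
  symm
  refine repCls_congr (LinearEquiv.ofBijective
    ((Algebra.linearMap ℂ BinPoly).codRestrict (binForms 0) fun z => isHomogeneous_C _ z)
    ⟨fun a b h => C_injective _ _ (Subtype.ext_iff.mp h), ?_⟩) ?_
  · rintro ⟨p, hp⟩
    replace hp : p ∈ homogeneousSubmodule (Fin 2) ℂ 0 := hp
    rw [homogeneousSubmodule_zero] at hp
    obtain ⟨z, hz⟩ := Submodule.mem_one.mp hp
    exact ⟨z, Subtype.ext hz⟩
  · intro g z
    refine Subtype.ext ?_
    exact ((linSubst (π g)).commutes z).symm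

theorem repCls_symRep_one : repCls (symRep π 1) = repCls (stdRep π) := by
  symm
  refine repCls_congr (LinearEquiv.ofBijective
    (linForm.codRestrict (binForms 1) fun v => isHomogeneous_linForm v) ⟨?_, ?_⟩) ?_
  · intro v w h
    have h1 : linForm v = linForm w := Subtype.ext_iff.mp h
    have := congrArg (fun p : BinPoly => fun i => coeff (Finsupp.single i 1) p) h1
    ext i
    have h2 := congrFun this i
    fin_cases i <;> simpa [linForm_apply, coeff_X, Finsupp.single_left_inj] using h2
  · rintro ⟨p, hp⟩
    replace hp : p ∈ homogeneousSubmodule (Fin 2) ℂ 1 := hp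
    rw [homogeneousSubmodule_one_eq_span_X] at hp
    have hr : p ∈ LinearMap.range linForm := by
      rw [linForm, Fintype.range_linearCombination]; exact hp
    obtain ⟨v, hv⟩ := hr
    exact ⟨v, Subtype.ext hv⟩
  · intro g v
    exact Subtype.ext (linSubst_linForm (π g) v).symm

/-- Multiplication of a vector, viewed as a linear form, with a form. -/
def formMul (n : ℕ) : TensorProduct ℂ (Fin 2 → ℂ) (binForms n) →ₗ[ℂ] binForms (n + 1) :=
  TensorProduct.lift (LinearMap.mk₂ ℂ
    (fun v p => (⟨linForm v * p.1, by
      have := (isHomogeneous_linForm v).mul p.2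
      rwa [add_comm] at this⟩ : binForms (n + 1)))
    (fun _ _ _ => Subtype.ext (by simp [add_mul])) (fun _ _ _ => Subtype.ext (by simp))
    (fun _ _ _ => Subtype.ext (by simp [mul_add])) (fun _ _ _ => Subtype.ext (by simp)))

theorem formMul_tmul (n : ℕ) (v : Fin 2 → ℂ) (p : binForms n) :
    (formMul n (v ⊗ₜ p) : BinPoly) = linForm v * p.1 := rfl

/-- Multiplication of a form by a variable. -/
def mulVar (i : Fin 2) (n : ℕ) : binForms n →ₗ[ℂ] binForms (n + 1) :=
  (LinearMap.mulRight ℂ (X i : BinPoly)).restrict fun _ hp =>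
    IsHomogeneous.mul hp (isHomogeneous_X ℂ i)

theorem mulVar_coe (i : Fin 2) (n : ℕ) (p : binForms n) : (mulVar i n p : BinPoly) = p.1 * X i := rfl

/-- The Koszul map. -/
def koszulMap (n : ℕ) : binForms n →ₗ[ℂ] TensorProduct ℂ (Fin 2 → ℂ) (binForms (n + 1)) :=
  TensorProduct.mk ℂ _ _ (Pi.single 0 1) ∘ₗ mulVar 1 n -
    TensorProduct.mk ℂ _ _ (Pi.single 1 1) ∘ₗ mulVar 0 n

theorem koszulMap_apply (n : ℕ) (p : binForms n) :
    koszulMap n p = Pi.single 0 1 ⊗ₜ mulVar 1 n p - Pi.single 1 1 ⊗ₜ mulVar 0 n p := rfl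

open TensorProduct in
theorem tensor_eq_single (n : ℕ) (t : TensorProduct ℂ (Fin 2 → ℂ) (binForms n)) :
    ∃ a b : binForms n, t = Pi.single 0 1 ⊗ₜ a + Pi.single 1 1 ⊗ₜ b := by
  induction t with
  | zero => exact ⟨0, 0, by simp⟩
  | add s t hs ht =>
    obtain ⟨a, b, rfl⟩ := hs
    obtain ⟨c, d, rfl⟩ := ht
    exact ⟨a + c, b + d, by simp only [tmul_add]; abel⟩
  | tmul v p =>
    refine ⟨v 0 • p, v 1 • p, ?_⟩
    rw [tmul_smul, tmul_smul, smul_tmul', smul_tmul', ← add_tmul]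
    congr 1
    ext i
    fin_cases i <;> simp

/-- Extraction of the part along a coordinate. -/
def tensorCoord (i : Fin 2) (n : ℕ) : TensorProduct ℂ (Fin 2 → ℂ) (binForms n) →ₗ[ℂ] binForms n :=
  (TensorProduct.lid ℂ (binForms n)).toLinearMap ∘ₗ
    (LinearMap.proj (R := ℂ) (φ := fun _ : Fin 2 => ℂ) i).rTensor _

theorem tensorCoord_tmul (i : Fin 2) (n : ℕ) (v : Fin 2 → ℂ) (p : binForms n) :
    tensorCoord i n (v ⊗ₜ p) = v i • p := by simp [tensorCoord]

theorem exists_eq_X_zero_mul_add (p : BinPoly) (n : ℕ) (hp : p ∈ binForms (n + 1)) :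
    ∃ a ∈ binForms n, ∃ b ∈ binForms n, p = X 0 * a + X 1 * b := by
  replace hp : p ∈ homogeneousSubmodule (Fin 2) ℂ (n + 1) := hp
  rw [← homogeneousSubmodule_one_pow, pow_succ', homogeneousSubmodule_one_pow] at hp
  induction hp using Submodule.mul_induction_on' with
  | mem_mul_mem m hm q hq =>
    rw [homogeneousSubmodule_one_eq_span_X, ← Fintype.range_linearCombination ℂ] at hm
    obtain ⟨v, rfl⟩ := hm
    change ∃ a ∈ binForms n, ∃ b ∈ binForms n, linForm v * q = _
    refine ⟨v 0 • q, Submodule.smul_mem _ _ hq, v 1 • q, Submodule.smul_mem _ _ hq, ?_⟩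
    rw [linForm_apply, add_mul, smul_mul_assoc, smul_mul_assoc, mul_smul_comm, mul_smul_comm]
  | add x _ y _ hx hy =>
    obtain ⟨a, ha, b, hb, rfl⟩ := hx
    obtain ⟨c, hc, d, hd, rfl⟩ := hy
    exact ⟨a + c, Submodule.add_mem _ ha hc, b + d, Submodule.add_mem _ hb hd, by ring⟩

/-- Exactness in the middle of the Koszul complex: the prime `X 1` divides `X 0 * a` but not `X 0`,
hence it divides `a`. -/
theorem X_zero_mul_add_eq_zero {a b : BinPoly} {n : ℕ} (ha : a ∈ binForms (n + 1))
    (h : X 0 * a + X 1 * b = 0) : ∃ p ∈ binForms n, a = p * X 1 ∧ b = -(p * X 0) := by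
  have hdvd : (X 1 : BinPoly) ∣ X 0 * a := ⟨-b, by linear_combination h⟩
  have hprime : Prime (X 1 : BinPoly) := X_prime
  have h10 : ¬ (X 1 : BinPoly) ∣ X 0 := by
    rw [X_dvd_X]; simp
  obtain ⟨p, hp⟩ := (hprime.dvd_or_dvd hdvd).resolve_left h10
  refine ⟨p, ?_, by rw [hp, mul_comm], ?_⟩
  · intro d hd
    by_contra hne
    refine hd ?_
    rw [← coeff_mul_X d 1 p, mul_comm, ← hp]
    refine IsHomogeneous.coeff_eq_zero ha ?_
    rw [Finsupp.degree_eq_weight_one, map_add]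
    intro h
    apply hne
    have h1 : Finsupp.weight (1 : Fin 2 → ℕ) (Finsupp.single 1 1) = 1 := by
      simp [Finsupp.weight_single]
    exact Nat.add_right_cancel (h.trans (congrArg (n + ·) h1.symm))
  · refine mul_left_cancel₀ hprime.ne_zero ?_
    rw [hp] at h
    linear_combination h

/-- The source of the determinant twist: an antisymmetric tensor is scaled by the determinant of a
substitution. -/
theorem koszul_tensor_identity {V W : Type*} [AddCommGroup V] [Module ℂ V] [AddCommGroup W]
    [Module ℂ W] (a b c d : ℂ) (e f : V) (x y : W) :
    (a * d - b * c) • (e ⊗ₜ[ℂ] y - f ⊗ₜ[ℂ] x) =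
      (a • e + c • f) ⊗ₜ[ℂ] (b • x + d • y) - (b • e + d • f) ⊗ₜ[ℂ] (a • x + c • y) := by
  simp only [TensorProduct.add_tmul, TensorProduct.tmul_add, TensorProduct.tmul_smul,
    ← TensorProduct.smul_tmul']
  module

theorem koszulMap_equivariant (n : ℕ) (g : G) (p : binForms n) :
    koszulMap n (twistRep (detChar π) (symRep π n) g p) =
      (stdRep π).tprod (symRep π (n + 1)) g (koszulMap n p) := by
  have hv : ∀ j, (π g).mulVec (Pi.single j 1) =
      π g 0 j • (Pi.single 0 1 : Fin 2 → ℂ) + π g 1 j • (Pi.single 1 1 : Fin 2 → ℂ) := by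
    intro j
    ext i
    fin_cases i <;> simp
  have hm : ∀ j, symRep π (n + 1) g (mulVar j n p) =
      π g 0 j • mulVar 0 n (symRep π n g p) + π g 1 j • mulVar 1 n (symRep π n g p) := by
    intro j
    refine Subtype.ext ?_
    rw [symRep_coe, mulVar_coe, Submodule.coe_add, Submodule.coe_smul, Submodule.coe_smul,
      mulVar_coe, mulVar_coe, symRep_coe, map_mul, linSubst_X, linForm_apply, mul_add,
      mul_smul_comm, mul_smul_comm]
    simp only [Matrix.col_apply]
  rw [twistRep_apply, detChar_apply, map_smul, koszulMap_apply, koszulMap_apply, map_sub,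
    Representation.tprod_apply, TensorProduct.map_tmul, TensorProduct.map_tmul,
    stdRep_apply, stdRep_apply, hv, hv, hm, hm,
    Matrix.det_fin_two]
  exact koszul_tensor_identity _ _ _ _ _ _ _ _

/-- The exact sequence `0 → det ⊗ S_n → V ⊗ S_{n+1} → S_{n+2} → 0`, with multiplication of forms as
its second map. -/
theorem koszul_repCls [Finite G] (n : ℕ) :
    repCls (stdRep π) * repCls (symRep π (n + 1)) =
      repCls (charRep (detChar π)) * repCls (symRep π n) + repCls (symRep π (n + 2)) := by
  rw [← repCls_tprod, ← repCls_twistRep]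
  refine repCls_exact (koszulMap n) (formMul (n + 1)) ?_ ?_ ?_ ?_ ?_
  · exact koszulMap_equivariant π n
  · intro g t
    induction t with
    | zero => simp
    | add a b ha hb => simp only [map_add, ha, hb]
    | tmul v p =>
      refine Subtype.ext ?_
      change _ = polyRep π g (linForm v * p.1)
      rw [polyRep_mul, polyRep_apply, linSubst_linForm]
      rfl
  · intro p q h
    have := congrArg (tensorCoord 0 (n + 1)) h
    simp only [koszulMap_apply, map_sub, tensorCoord_tmul] at this
    have h2 := Subtype.ext_iff.mp this
    simp [mulVar_coe] at h2
    exact h2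
  · rintro ⟨p, hp⟩
    obtain ⟨a, ha, b, hb, rfl⟩ := exists_eq_X_zero_mul_add p (n + 1) hp
    refine ⟨Pi.single 0 1 ⊗ₜ ⟨a, ha⟩ + Pi.single 1 1 ⊗ₜ ⟨b, hb⟩, Subtype.ext ?_⟩
    rw [map_add, Submodule.coe_add, formMul_tmul, formMul_tmul, linForm_single, linForm_single]
  · intro t
    obtain ⟨a, b, rfl⟩ := tensor_eq_single _ t
    rw [map_add, Subtype.ext_iff, Submodule.coe_add, formMul_tmul, formMul_tmul, linForm_single,
      linForm_single]
    constructor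
    · intro h
      obtain ⟨p, hp, h1, h2⟩ := X_zero_mul_add_eq_zero a.2 h
      refine ⟨⟨p, hp⟩, ?_⟩
      have e1 : mulVar 1 n ⟨p, hp⟩ = a := Subtype.ext h1.symm
      have e2 : mulVar 0 n ⟨p, hp⟩ = -b := Subtype.ext (by simp [mulVar_coe, h2])
      rw [koszulMap_apply, e1, e2, TensorProduct.tmul_neg, sub_neg_eq_add]
    · rintro ⟨p, hp⟩
      have h0 := congrArg (tensorCoord 0 (n + 1)) hp
      have h1 := congrArg (tensorCoord 1 (n + 1)) hp
      simp [koszulMap_apply, map_sub, tensorCoord_tmul] at h0 h1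
      rw [← h0, ← h1]
      simp [mulVar_coe]
      ring

end PolyRep

/-! ### Graded ideals in dehomogenized form -/

section Truncation

open Polynomial

variable {J : ℕ → Submodule ℂ ℂ[X]}

/-- After setting the second variable to `1`, the hypotheses `h1` and `hX` express closure under
multiplication by the two variables. -/
theorem mul_mem_of_natDegree_le (h1 : ∀ n, ∀ p ∈ J n, p ∈ J (n + 1))
    (hX : ∀ n, ∀ p ∈ J n, p * X ∈ J (n + 1)) {m k : ℕ} {h t : ℂ[X]} (hh : h ∈ J m)
    (ht : t.natDegree ≤ k) : h * t ∈ J (m + k) := by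
  have hmono : ∀ {a b : ℕ} {p : ℂ[X]}, a ≤ b → p ∈ J a → p ∈ J b := by
    intro a b p hab hp
    induction b, hab using Nat.le_induction with
    | base => exact hp
    | succ b _ ih => exact h1 _ _ ih
  have hpow : ∀ i, h * X ^ i ∈ J (m + i) := by
    intro i
    induction i with
    | zero => simpa using hh
    | succ i ih => rw [pow_succ, ← mul_assoc]; exact hX _ _ ih
  rw [t.as_sum_range_C_mul_X_pow, Finset.mul_sum]
  refine Submodule.sum_mem _ fun i hi => ?_
  rw [mul_left_comm, ← smul_eq_C_mul]
  refine Submodule.smul_mem _ _ (hmono ?_ (hpow i))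
  have := Finset.mem_range.mp hi
  omega

/-- A nonzero graded ideal of binary forms (in dehomogenized shape) agrees in large degrees with a
principal one. -/
theorem exists_eventually_principal (d : ℕ) (hdeg : ∀ n, ∀ p ∈ J n, p.natDegree ≤ n + d)
    (h1 : ∀ n, ∀ p ∈ J n, p ∈ J (n + 1)) (hX : ∀ n, ∀ p ∈ J n, p * X ∈ J (n + 1))
    (hne : ∃ n, ∃ p ∈ J n, p ≠ 0) :
    ∃ (q : ℂ[X]) (c n₀ : ℕ), q ≠ 0 ∧ q.natDegree ≤ c ∧ ∀ n, n₀ ≤ n → c ≤ n + d ∧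
      ∀ p, p ∈ J n ↔ ∃ s : ℂ[X], s.natDegree ≤ n + d - c ∧ p = q * s := by
  have hmono : ∀ {a b : ℕ} {p : ℂ[X]}, a ≤ b → p ∈ J a → p ∈ J b := by
    intro a b p hab hp
    induction b, hab using Nat.le_induction with
    | base => exact hp
    | succ b _ ih => exact h1 _ _ ih
  let I : Ideal ℂ[X] :=
    { carrier := {p | ∃ n, p ∈ J n}
      add_mem' := by
        rintro a b ⟨m, hm⟩ ⟨n, hn⟩
        exact ⟨max m n, Submodule.add_mem _ (hmono (le_max_left _ _) hm)
          (hmono (le_max_right _ _) hn)⟩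
      zero_mem' := ⟨0, Submodule.zero_mem _⟩
      smul_mem' := by
        rintro t p ⟨n, hn⟩
        refine ⟨n + t.natDegree, ?_⟩
        rw [smul_eq_mul, mul_comm]
        exact mul_mem_of_natDegree_le h1 hX hn le_rfl }
  obtain ⟨q, hq⟩ := (IsPrincipalIdealRing.principal I).principal
  have hqI : q ∈ I := by rw [hq]; exact Submodule.mem_span_singleton_self q
  obtain ⟨n0, hn0⟩ := hqI
  have hdvd : ∀ n, ∀ p ∈ J n, q ∣ p := by
    intro n p hp
    have : p ∈ I := ⟨n, hp⟩
    rw [hq] at this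
    exact Ideal.mem_span_singleton.mp this
  obtain ⟨m, h, hm, hh0⟩ := hne
  have hq0 : q ≠ 0 := by
    rintro rfl
    exact hh0 (zero_dvd_iff.mp (hdvd m h hm))
  -- The drop `n + d - p.natDegree` is the power of the second variable lost on dehomogenizing. Its
  -- minimum `e` is the power common to all members, so the generator has degree `c = q.natDegree +
  -- e`.
  have hex : ∃ e n p, p ∈ J n ∧ p ≠ 0 ∧ n + d = p.natDegree + e :=
    ⟨m + d - h.natDegree, m, h, hm, hh0, by have := hdeg m h hm; omega⟩
  classical
  obtain ⟨n1, p1, hp1, hp10, he⟩ := Nat.find_spec hex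
  have hmin : ∀ n, ∀ p ∈ J n, p ≠ 0 → p.natDegree + Nat.find hex ≤ n + d := by
    intro n p hp hp0
    have := hdeg n p hp
    have := Nat.find_min' hex ⟨n, p, hp, hp0,
      show n + d = p.natDegree + (n + d - p.natDegree) by omega⟩
    omega
  generalize Nat.find hex = e at he hmin
  obtain ⟨s1, rfl⟩ := hdvd n1 p1 hp1
  have hs10 : s1 ≠ 0 := right_ne_zero_of_mul hp10
  rw [natDegree_mul hq0 hs10] at he
  refine ⟨q, q.natDegree + e, n0 + n1 + s1.natDegree, hq0, by omega, fun n hn => ⟨by omega, ?_⟩⟩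
  intro p
  constructor
  · intro hp
    obtain ⟨s, rfl⟩ := hdvd n p hp
    refine ⟨s, ?_, rfl⟩
    by_cases hs : s = 0
    · simp [hs]
    · have := hmin n _ hp (mul_ne_zero hq0 hs)
      rw [natDegree_mul hq0 hs] at this
      omega
  · rintro ⟨s, hs, rfl⟩
    -- The multiple `q * s1` attains the minimal drop, so the quotient part lands in `J n` without
    -- loss of degree; the remainder has bounded degree and is absorbed by taking `n` large.
    have hdiv : s1 * (s / s1) + s % s1 = s := EuclideanDomain.div_add_mod s s1
    have hr : (s % s1).natDegree ≤ s1.natDegree :=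
      natDegree_le_natDegree (EuclideanDomain.mod_lt s hs10).le
    have hu : (s / s1).natDegree ≤ s.natDegree - s1.natDegree := by
      by_cases hlt : s.degree < s1.degree
      · rw [(Polynomial.div_eq_zero_iff hs10).mpr hlt, natDegree_zero]
        exact Nat.zero_le _
      · by_cases h0 : s / s1 = 0
        · simp [h0]
        · have h2 := degree_add_div hs10 (not_lt.mp hlt)
          rw [← degree_mul] at h2
          have h3 := natDegree_eq_of_degree_eq h2
          rw [natDegree_mul hs10 h0] at h3
          omega
    rw [← hdiv, mul_add, ← mul_assoc]
    refine Submodule.add_mem _ ?_ ?_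
    · refine hmono ?_ (mul_mem_of_natDegree_le h1 hX hp1 (le_refl (s / s1).natDegree))
      omega
    · refine hmono ?_ (mul_mem_of_natDegree_le h1 hX hn0 hr)
      omega

end Truncation

/-! ### Graded ideals of binary forms are eventually principal -/

section Forms

open MvPolynomial

/-- Dehomogenization of binary polynomials. -/
def dehom : BinPoly →ₐ[ℂ] Polynomial ℂ := aeval ![Polynomial.X, 1]

theorem natDegree_dehom_le {p : BinPoly} {n : ℕ} (hp : p ∈ binForms n) :
    (dehom p).natDegree ≤ n := by
  rw [p.as_sum, map_sum]
  refine Polynomial.natDegree_sum_le_of_forall_le _ _ fun d hd => ?_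
  have h := IsHomogeneous.degree_eq_sum_deg_support hp hd
  have h2 : d 0 + d 1 = n := by
    rw [h, ← Finsupp.degree_apply, Finsupp.degree_eq_sum, Fin.sum_univ_two]
  rw [dehom, aeval_monomial, Finsupp.prod_fintype _ _ (by simp), Fin.prod_univ_two]
  simp only [Matrix.cons_val_zero, Matrix.cons_val_one, one_pow, mul_one]
  refine (Polynomial.natDegree_C_mul_X_pow_le _ _).trans (by omega)

theorem homogenize_dehom {p : BinPoly} {n : ℕ} (hp : p ∈ binForms n) :
    (dehom p).homogenize n = p := Polynomial.homogenize_eq_of_isHomogeneous hp rfl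

/-- A nonzero graded ideal of binary forms agrees in large degrees with a principal one. -/
theorem exists_eventually_eq_map_mulLeft {I : ℕ → Submodule ℂ BinPoly} (d : ℕ)
    (hI : ∀ n, I n ≤ binForms (n + d)) (hX : ∀ n, ∀ p ∈ I n, ∀ i, X i * p ∈ I (n + 1))
    (hne : ∃ n, ∃ p ∈ I n, p ≠ 0) :
    ∃ (f : BinPoly) (c n₀ : ℕ), f ≠ 0 ∧ f ∈ binForms c ∧ ∀ n, n₀ ≤ n → c ≤ n + d ∧
      I n = (binForms (n + d - c)).map (LinearMap.mulLeft ℂ f) := by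
  obtain ⟨q, c, n₀, hq0, hqc, hn⟩ := exists_eventually_principal
      (J := fun n => (I n).map dehom.toLinearMap) d
    (by rintro n _ ⟨p, hp, rfl⟩; exact natDegree_dehom_le (hI n hp))
    (by
      rintro n _ ⟨p, hp, rfl⟩
      refine ⟨X 1 * p, hX n p hp 1, ?_⟩
      simp [dehom])
    (by
      rintro n _ ⟨p, hp, rfl⟩
      refine ⟨X 0 * p, hX n p hp 0, ?_⟩
      simp [dehom, mul_comm])
    (by
      obtain ⟨n, p, hp, hp0⟩ := hne
      refine ⟨n, _, ⟨p, hp, rfl⟩, fun h => hp0 ?_⟩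
      rw [← homogenize_dehom (hI n hp), show dehom p = 0 from h, Polynomial.homogenize_zero])
  refine ⟨q.homogenize c, c, n₀, ?_, Polynomial.isHomogeneous_homogenize q, fun n hn' =>
    ⟨(hn n hn').1, ?_⟩⟩
  · rwa [Ne, Polynomial.homogenize_eq_zero_iff hqc]
  · obtain ⟨hc, hmem⟩ := hn n hn'
    have hdeg : c + (n + d - c) = n + d := by omega
    ext p
    constructor
    · intro hp
      obtain ⟨s, hs, hps⟩ := (hmem (dehom p)).mp ⟨p, hp, rfl⟩
      refine ⟨s.homogenize (n + d - c), Polynomial.isHomogeneous_homogenize s, ?_⟩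
      rw [LinearMap.mulLeft_apply, ← Polynomial.homogenize_mul _ _ hqc hs, ← hps, hdeg,
        homogenize_dehom (hI n hp)]
    · rintro ⟨s, hs, rfl⟩
      rw [LinearMap.mulLeft_apply]
      obtain ⟨p, hp, hp2⟩ := (hmem (q * dehom s)).mpr ⟨dehom s, natDegree_dehom_le hs, rfl⟩
      have : q.homogenize c * s = p := by
        rw [← homogenize_dehom (hI n hp), show dehom p = _ from hp2, ← hdeg,
          Polynomial.homogenize_mul _ _ hqc (natDegree_dehom_le hs), homogenize_dehom hs]
      rwa [this]

/-- Uniqueness of the generator up to scalars. Testing on `X 1 ^ m` gives `f' = f * s` after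
dehomogenizing; testing on `X 0 ^ m` leaves no room for `s` to have positive degree. -/
theorem exists_eq_smul_of_mul_binForms {f f' : BinPoly} {c m : ℕ} (hf : f ∈ binForms c)
    (hf' : f' ∈ binForms c) (hf0 : f ≠ 0)
    (h : ∀ t ∈ binForms m, ∃ s ∈ binForms m, f' * t = f * s) : ∃ a : ℂ, f' = a • f := by
  have hq0 : dehom f ≠ 0 := fun h0 => hf0 (by
    rw [← homogenize_dehom hf, h0, Polynomial.homogenize_zero])
  obtain ⟨s, hs, h1⟩ := h (X 1 ^ m) (isHomogeneous_X_pow 1 m)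
  obtain ⟨u, hu, h2⟩ := h (X 0 ^ m) (isHomogeneous_X_pow 0 m)
  replace h1 := congrArg dehom h1
  replace h2 := congrArg dehom h2
  simp only [map_mul, map_pow] at h1 h2
  have e1 : dehom (X 1) = 1 := by simp [dehom]
  have e0 : dehom (X 0) = Polynomial.X := by simp [dehom]
  rw [e1, one_pow, mul_one] at h1
  rw [e0, h1, mul_assoc] at h2
  replace h2 := mul_left_cancel₀ hq0 h2
  have hu' := natDegree_dehom_le hu
  have hs0 : (dehom s).natDegree = 0 := by
    by_cases hs0 : dehom s = 0
    · simp [hs0]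
    · rw [← h2, Polynomial.natDegree_mul_X_pow _ hs0] at hu'
      omega
  obtain ⟨a, ha⟩ := Polynomial.natDegree_eq_zero.mp hs0
  refine ⟨a, ?_⟩
  rw [← homogenize_dehom hf', h1, ← ha, mul_comm, Polynomial.homogenize_C_mul,
    homogenize_dehom hf, smul_eq_C_mul]

end Forms

/-! ### Stable graded modules and the subring of characters -/

section Gen

open MvPolynomial

variable {G : Type*} [Group G] (π : G →* Matrix (Fin 2) (Fin 2) ℂ)

/-- The subring generated by the standard representation and the linear characters. -/
def charSubring : Subring (RepRing G) :=
  Subring.closure ({repCls (stdRep π)} ∪ Set.range fun χ : G →* ℂ => repCls (charRep χ))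

theorem charRep_mem (χ : G →* ℂ) : repCls (charRep χ) ∈ charSubring π :=
  Subring.subset_closure (Or.inr ⟨χ, rfl⟩)

theorem stdRep_mem : repCls (stdRep π) ∈ charSubring π := Subring.subset_closure (Or.inl rfl)

theorem symRep_mem [Finite G] (n : ℕ) : repCls (symRep π n) ∈ charSubring π := by
  induction n using Nat.twoStepInduction with
  | zero => rw [repCls_symRep_zero]; exact one_mem _
  | one => rw [repCls_symRep_one]; exact stdRep_mem π
  | more n h0 h1 =>
    rw [eq_sub_of_add_eq' (koszul_repCls π n).symm]
    exact sub_mem (mul_mem (stdRep_mem π) h1) (mul_mem (charRep_mem π _) h0)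

/-- In large degrees the classes of a stable graded ideal lie in `charSubring`. -/
theorem eventually_subCls_mem [Finite G] {I : ℕ → Submodule ℂ BinPoly} (d : ℕ)
    [∀ n, FiniteDimensional ℂ (I n)]
    (hI : ∀ n, I n ≤ binForms (n + d)) (hX : ∀ n, ∀ p ∈ I n, ∀ i, X i * p ∈ I (n + 1))
    (hG : ∀ n g, I n ≤ (I n).comap (polyRep π g)) :
    ∃ n₀, ∀ n, n₀ ≤ n → subCls (polyRep π) (I n) (hG n) ∈ charSubring π := by
  by_cases hne : ∃ n, ∃ p ∈ I n, p ≠ 0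
  · obtain ⟨f, c, n₀, hf0, hf, h⟩ := exists_eventually_eq_map_mulLeft d hI hX hne
    have hχ : ∀ g, ∃ a : ℂ, polyRep π g f = a • f := by
      intro g
      obtain ⟨hc, hn⟩ := h n₀ le_rfl
      -- Both `f` and its translate by `g` generate the stable space `I n₀`, so they are
      -- proportional; the factor will be the character `χ`.
      refine exists_eq_smul_of_mul_binForms (m := n₀ + d - c) hf (binForms_stable π c g hf) hf0 ?_
      intro t ht
      have ht' := binForms_stable π _ g⁻¹ ht
      have h1 : f * polyRep π g⁻¹ t ∈ I n₀ := by rw [hn]; exact ⟨_, ht', rfl⟩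
      have h2 := hG n₀ g h1
      rw [Submodule.mem_comap, polyRep_mul, Representation.self_inv_apply, hn] at h2
      obtain ⟨s, hs, hs2⟩ := h2
      exact ⟨s, hs, hs2.symm⟩
    choose a ha using hχ
    have hinj : ∀ {x y : ℂ}, x • f = y • f → x = y := fun h => smul_left_injective ℂ hf0 h
    let χ : G →* ℂ :=
      { toFun := a
        map_one' := hinj (by rw [← ha, map_one, one_smul, Module.End.one_apply])
        map_mul' := fun g g' => hinj (by
          rw [← ha, map_mul, Module.End.mul_apply, ha, map_smul, ha, smul_smul, mul_comm]) }
    refine ⟨n₀, fun n hn => ?_⟩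
    obtain ⟨hc, hIn⟩ := h n hn
    have e : subCls (polyRep π) (I n) (hG n) = repCls (twistRep χ (symRep π (n + d - c))) := by
      symm
      refine repCls_congr (LinearEquiv.ofBijective ((LinearMap.mulLeft ℂ f).restrict
        (p := binForms (n + d - c)) (q := I n) fun p hp => by rw [hIn]; exact ⟨p, hp, rfl⟩)
        ⟨?_, ?_⟩) ?_
      · intro p q hpq
        exact Subtype.ext (mul_left_cancel₀ hf0 (Subtype.ext_iff.mp hpq))
      · rintro ⟨p, hp⟩
        have hp' := hp
        rw [hIn] at hp'
        obtain ⟨s, hs, hs2⟩ := hp'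
        exact ⟨⟨s, hs⟩, Subtype.ext hs2⟩
      · intro g p
        refine Subtype.ext ?_
        change f * (a g • polyRep π g p.1) = polyRep π g (f * p.1)
        rw [polyRep_mul, ha, mul_smul_comm, smul_mul_assoc]
    rw [e, repCls_twistRep]
    exact mul_mem (charRep_mem π χ) (symRep_mem π _)
  · push Not at hne
    refine ⟨0, fun n _ => ?_⟩
    have : Subsingleton (I n) := ⟨fun x y => Subtype.ext (by
      rw [hne n x.1 x.2, hne n y.1 y.2])⟩
    rw [subCls, repCls_eq_zero]
    exact zero_mem _

/-- The classes of a graded module embedded in a finite sum of shifts of the polynomial ring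
eventually lie in `charSubring`. -/
theorem eventually_subCls_mem_of_maps [Finite G] {T : Type} [AddCommGroup T] [Module ℂ T]
    [Module BinPoly T] (ρ : Representation ℂ G T) (L : List (ℕ × (T →ₗ[ℂ] BinPoly)))
    (hLlin : ∀ F ∈ L, ∀ i t, F.2 ((X i : BinPoly) • t) = X i * F.2 t)
    (hLG : ∀ F ∈ L, ∀ g t, F.2 (ρ g t) = polyRep π g (F.2 t))
    (N : ℕ → Submodule ℂ T) [∀ n, FiniteDimensional ℂ (N n)]
    (hN : ∀ n, ∀ t ∈ N n, ∀ i, (X i : BinPoly) • t ∈ N (n + 1))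
    (hG : ∀ n g, N n ≤ (N n).comap (ρ g))
    (hLN : ∀ F ∈ L, ∀ n, ∀ t ∈ N n, F.2 t ∈ binForms (n + F.1))
    (hinj : ∀ n, ∀ t ∈ N n, (∀ F ∈ L, F.2 t = 0) → t = 0) :
    ∃ n₀, ∀ n, n₀ ≤ n → subCls ρ (N n) (hG n) ∈ charSubring π := by
  -- The first map sends `N` onto a stable graded ideal; its kernel in `N` is still graded and is
  -- separated by the remaining maps.
  induction L generalizing N with
  | nil =>
    refine ⟨0, fun n _ => ?_⟩
    have : Subsingleton (N n) := ⟨fun x y => Subtype.ext (by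
      rw [hinj n x.1 x.2 (by simp), hinj n y.1 y.2 (by simp)])⟩
    rw [subCls, repCls_eq_zero]
    exact zero_mem _
  | cons F L ih =>
    simp only [List.mem_cons, forall_eq_or_imp] at hLlin hLG hLN hinj
    have hK : ∀ n g, N n ⊓ LinearMap.ker F.2 ≤ (N n ⊓ LinearMap.ker F.2).comap (ρ g) := by
      rintro n g t ⟨h1, h2⟩
      refine ⟨hG n g h1, ?_⟩
      rw [SetLike.mem_coe, LinearMap.mem_ker] at h2 ⊢
      rw [hLG.1, h2, map_zero]
    have hI : ∀ n g, (N n).map F.2 ≤ ((N n).map F.2).comap (polyRep π g) := by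
      rintro n g _ ⟨t, ht, rfl⟩
      exact ⟨ρ g t, hG n g ht, hLG.1 g t⟩
    obtain ⟨n₁, h₁⟩ := ih hLlin.2 hLG.2 (fun n => N n ⊓ LinearMap.ker F.2)
      (by
        rintro n t ⟨h1, h2⟩ i
        refine ⟨hN n t h1 i, ?_⟩
        rw [SetLike.mem_coe, LinearMap.mem_ker] at h2 ⊢
        rw [hLlin.1, h2, mul_zero]) hK
      (fun F' hF' n t ht => hLN.2 F' hF' n t ht.1)
      (fun n t ht h => hinj n t ht.1 ⟨ht.2, h⟩)
    obtain ⟨n₂, h₂⟩ := eventually_subCls_mem π (I := fun n => (N n).map F.2) F.1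
      (by rintro n _ ⟨t, ht, rfl⟩; exact hLN.1 n t ht)
      (by
        rintro n _ ⟨t, ht, rfl⟩ i
        exact ⟨_, hN n t ht i, hLlin.1 i t⟩) hI
    refine ⟨max n₁ n₂, fun n hn => ?_⟩
    rw [subCls_eq_inf_ker_add_map ρ (polyRep π) F.2 hLG.1 (N n) (hG n) (hK n) (hI n)]
    exact add_mem (h₁ n ((le_max_left _ _).trans hn)) (h₂ n ((le_max_right _ _).trans hn))

end Gen

/-! ### Equivariant embedding of `S ⊗ A` and descent to degree zero -/

section Embedding

open MvPolynomial

theorem exists_eval_eq_one_and_forall_eq_zero (p : Fin 2 → ℂ) (S : Finset (Fin 2 → ℂ))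
    (hp : p ∉ S) : ∃ f : BinPoly, eval p f = 1 ∧ ∀ q ∈ S, eval q f = 0 := by
  classical
  induction S using Finset.induction_on with
  | empty => exact ⟨1, by simp, by simp⟩
  | insert q S hq ih =>
    rw [Finset.mem_insert, not_or] at hp
    obtain ⟨f, hf1, hf0⟩ := ih hp.2
    obtain ⟨i, hi⟩ := Function.ne_iff.mp hp.1
    refine ⟨f * (C (p i - q i)⁻¹ * (X i - C (q i))), ?_, ?_⟩
    · simp [hf1, inv_mul_cancel₀ (sub_ne_zero.mpr hi)]
    · intro r hr
      rcases Finset.mem_insert.mp hr with rfl | hr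
      · simp
      · simp [hf0 r hr]

variable {G : Type*} [Group G] (π : G →* Matrix (Fin 2) (Fin 2) ℂ)

theorem eval_polyRep (p : Fin 2 → ℂ) (g : G) (f : BinPoly) :
    eval p (polyRep π g f) = eval (Matrix.vecMul p (π g)) f := by
  have : (aeval p).comp (linSubst (π g)) = aeval (R := ℂ) (Matrix.vecMul p (π g)) := by
    refine algHom_ext fun j => ?_
    simp [linSubst_X, linForm_apply, Matrix.vecMul, dotProduct, Fin.sum_univ_two, mul_comm]
  exact AlgHom.congr_fun this f

/-- By faithfulness each nontrivial element fixes only a proper subspace, and finitely many of these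
cannot cover `ℂ²`. Points are row vectors because `polyRep` substitutes columns. -/
theorem exists_vecMul_ne [Finite G] (hπ : Function.Injective π) :
    ∃ p : Fin 2 → ℂ, ∀ g : G, g ≠ 1 → Matrix.vecMul p (π g) ≠ p := by
  by_contra! h
  have hcov : ⋃ g : {g : G // g ≠ 1},
      (LinearMap.ker (Matrix.vecMulLinear (π g) - LinearMap.id) : Set (Fin 2 → ℂ)) = Set.univ := by
    rw [Set.eq_univ_iff_forall]
    intro p
    obtain ⟨g, hg, hp⟩ := h p
    refine Set.mem_iUnion.mpr ⟨⟨g, hg⟩, ?_⟩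
    simp [hp]
  obtain ⟨⟨g, hg⟩, hker⟩ := Subspace.exists_eq_top_of_iUnion_eq_univ hcov
  refine hg (hπ ?_)
  rw [map_one]
  rw [LinearMap.ker_eq_top, sub_eq_zero] at hker
  ext i j
  have := congrFun (LinearMap.congr_fun hker (Pi.single i 1)) j
  simpa [Matrix.one_apply, Pi.single_apply, eq_comm] using this

theorem homogeneousComponent_polyRep (n : ℕ) (g : G) (f : BinPoly) :
    homogeneousComponent n (polyRep π g f) = polyRep π g (homogeneousComponent n f) := by
  conv_lhs => rw [← sum_homogeneousComponent f]
  rw [map_sum, map_sum]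
  have h : ∀ i, homogeneousComponent n (polyRep π g (homogeneousComponent i f)) =
      if n = i then polyRep π g (homogeneousComponent i f) else 0 := fun i =>
    homogeneousComponent_of_mem
      (binForms_stable π i g (homogeneousComponent_isHomogeneous i f))
  simp only [h, Finset.sum_ite_eq, Finset.mem_range]
  split_ifs with hn
  · rfl
  · rw [homogeneousComponent_eq_zero n f (by omega), map_zero]

variable {A : Type} [AddCommGroup A] [Module ℂ A]

/-- An equivariant map to polynomials interpolating a functional at a point with trivial
stabilizer. -/
theorem exists_equivariant_eval_eq [Finite G] (ρ : Representation ℂ G A) {p : Fin 2 → ℂ}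
    (hp : ∀ g : G, g ≠ 1 → Matrix.vecMul p (π g) ≠ p) (α : A →ₗ[ℂ] ℂ) :
    ∃ φ : A →ₗ[ℂ] BinPoly, (∀ g a, φ (ρ g a) = polyRep π g (φ a)) ∧ ∀ a, eval p (φ a) = α a := by
  classical
  have := Fintype.ofFinite G
  obtain ⟨f, hf1, hf0⟩ := exists_eval_eq_one_and_forall_eq_zero p
    ((Finset.univ.filter fun g : G => g ≠ 1).image fun g => Matrix.vecMul p (π g)) (by
      intro h
      obtain ⟨g, hg, hgp⟩ := Finset.mem_image.mp h
      exact hp g (Finset.mem_filter.mp hg).2 hgp)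
  -- Summing over the group gives equivariance; since `f` vanishes at all other points of the orbit
  -- of `p`, only `g = 1` contributes at `p`.
  let φ : A →ₗ[ℂ] BinPoly := ∑ g : G, (α ∘ₗ ρ g⁻¹).smulRight (polyRep π g f)
  have hφ : ∀ a, φ a = ∑ g : G, α (ρ g⁻¹ a) • polyRep π g f := fun a => by simp [φ]
  refine ⟨φ, fun h a => ?_, fun a => ?_⟩
  · rw [hφ, hφ, map_sum, ← Equiv.sum_comp (Equiv.mulLeft h)]
    refine Finset.sum_congr rfl fun g _ => ?_
    rw [map_smul, Equiv.coe_mulLeft, ← Module.End.mul_apply, ← map_mul, ← Module.End.mul_apply,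
      ← map_mul, mul_inv_rev, inv_mul_cancel_right]
  · rw [hφ, map_sum, Finset.sum_eq_single 1]
    · simp [smul_eval, hf1]
    · intro g _ hg
      rw [smul_eval, eval_polyRep, hf0 _ (Finset.mem_image.mpr ⟨g, by simpa using hg, rfl⟩),
        mul_zero]
    · simp

open TensorProduct

/-- The `BinPoly`-linear extension of a linear map with polynomial values. -/
def extendMap (φ : A →ₗ[ℂ] BinPoly) : BinPoly ⊗[ℂ] A →ₗ[ℂ] BinPoly :=
  LinearMap.mul' ℂ BinPoly ∘ₗ φ.lTensor BinPoly

theorem extendMap_tmul (φ : A →ₗ[ℂ] BinPoly) (p : BinPoly) (a : A) :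
    extendMap φ (p ⊗ₜ a) = p * φ a := rfl

theorem extendMap_sum {ι : Type*} (s : Finset ι) (ψ : ι → A →ₗ[ℂ] BinPoly)
    (t : BinPoly ⊗[ℂ] A) : extendMap (∑ i ∈ s, ψ i) t = ∑ i ∈ s, extendMap (ψ i) t := by
  induction t with
  | zero => simp
  | add a b ha hb => simp only [map_add, ha, hb, Finset.sum_add_distrib]
  | tmul p a => simp only [extendMap_tmul, LinearMap.sum_apply, Finset.mul_sum]

theorem extendMap_smul (φ : A →ₗ[ℂ] BinPoly) (q : BinPoly) (t : BinPoly ⊗[ℂ] A) :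
    extendMap φ (q • t) = q * extendMap φ t := by
  induction t with
  | zero => simp
  | add a b ha hb => simp only [smul_add, map_add, ha, hb, mul_add]
  | tmul p a => rw [smul_tmul', extendMap_tmul, extendMap_tmul, smul_eq_mul, mul_assoc]

theorem extendMap_equivariant (ρ : Representation ℂ G A) {φ : A →ₗ[ℂ] BinPoly}
    (hφ : ∀ g a, φ (ρ g a) = polyRep π g (φ a)) (g : G) (t : BinPoly ⊗[ℂ] A) :
    extendMap φ ((polyRep π).tprod ρ g t) = polyRep π g (extendMap φ t) := by
  induction t with
  | zero => simp
  | add a b ha hb => simp only [map_add, ha, hb]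
  | tmul p a =>
    rw [Representation.tprod_apply, map_tmul, extendMap_tmul, extendMap_tmul, polyRep_mul, hφ]

/-- The component of degree `n` of `BinPoly ⊗ A`. -/
def tensorForms (A : Type) [AddCommGroup A] [Module ℂ A] (n : ℕ) : Submodule ℂ (BinPoly ⊗[ℂ] A) :=
  LinearMap.range ((binForms n).subtype.rTensor A)

theorem tensorForms_induction {n : ℕ} {P : BinPoly ⊗[ℂ] A → Prop}
    (h0 : P 0) (hadd : ∀ s t, P s → P t → P (s + t)) (htmul : ∀ p ∈ binForms n, ∀ a, P (p ⊗ₜ a))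
    {t : BinPoly ⊗[ℂ] A} (ht : t ∈ tensorForms A n) : P t := by
  obtain ⟨s, rfl⟩ := ht
  induction s with
  | zero => simpa using h0
  | add a b ha hb => rw [map_add]; exact hadd _ _ ha hb
  | tmul p a => exact htmul p.1 p.2 a

theorem tmul_mem_tensorForms {n : ℕ} {p : BinPoly} (hp : p ∈ binForms n) (a : A) :
    p ⊗ₜ a ∈ tensorForms A n := ⟨(⟨p, hp⟩ : binForms n) ⊗ₜ a, rfl⟩

instance [FiniteDimensional ℂ A] (n : ℕ) : FiniteDimensional ℂ (tensorForms A n) :=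
  Module.Finite.range ((binForms n).subtype.rTensor A)

theorem tensorForms_stable (ρ : Representation ℂ G A) (n : ℕ) (g : G) :
    tensorForms A n ≤ (tensorForms A n).comap ((polyRep π).tprod ρ g) := by
  intro t ht
  refine tensorForms_induction (P := fun t => (polyRep π).tprod ρ g t ∈ tensorForms A n) ?_ ?_ ?_ ht
  · rw [map_zero]; exact zero_mem _
  · intro s t hs ht
    rw [map_add]; exact add_mem hs ht
  · intro p hp a
    exact tmul_mem_tensorForms (binForms_stable π n g hp) _

theorem subCls_tensorForms [FiniteDimensional ℂ A] (ρ : Representation ℂ G A) (n : ℕ) :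
    subCls ((polyRep π).tprod ρ) (tensorForms A n) (tensorForms_stable π ρ n) =
      repCls (symRep π n) * repCls ρ := by
  rw [← repCls_tprod]
  symm
  refine repCls_congr (LinearEquiv.ofInjective ((binForms n).subtype.rTensor A)
    (Module.Flat.rTensor_preserves_injective_linearMap _ (Submodule.subtype_injective _))) ?_
  intro g t
  refine Subtype.ext ?_
  change (binForms n).subtype.rTensor A ((symRep π n).tprod ρ g t) =
    (polyRep π).tprod ρ g ((binForms n).subtype.rTensor A t)
  induction t with
  | zero => simp
  | add a b ha hb => simp only [map_add, ha, hb]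
  | tmul p a => rfl

/-- The tensor product of a representation with high symmetric powers of the standard one lies in
`charSubring`. -/
theorem eventually_symRep_mul_mem [Finite G] (hπ : Function.Injective π) [FiniteDimensional ℂ A]
    (ρ : Representation ℂ G A) :
    ∃ n₀, ∀ n, n₀ ≤ n → repCls (symRep π n) * repCls ρ ∈ charSubring π := by
  obtain ⟨p, hp⟩ := exists_vecMul_ne π hπ
  let b := Module.finBasis ℂ A
  choose φ hφG hφ using fun i => exists_equivariant_eval_eq π ρ hp (b.coord i)
  let D : ℕ := Finset.univ.sup fun ij : Fin _ × Fin _ => (φ ij.1 (b ij.2)).totalDegree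
  have hD : ∀ i j, (φ i (b j)).totalDegree ≤ D := fun i j =>
    Finset.le_sup (f := fun ij : Fin _ × Fin _ => (φ ij.1 (b ij.2)).totalDegree)
      (Finset.mem_univ (i, j))
  -- The interpolating maps need not be homogeneous; their components of degree `d` stay equivariant
  -- and raise degrees by exactly `d`.
  let ψ : Fin (Module.finrank ℂ A) → ℕ → A →ₗ[ℂ] BinPoly := fun i d =>
    homogeneousComponent d ∘ₗ φ i
  have hψG : ∀ i d g a, ψ i d (ρ g a) = polyRep π g (ψ i d a) := fun i d g a => by
    simp only [ψ, LinearMap.comp_apply, hφG, homogeneousComponent_polyRep]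
  have hψsum : ∀ i, ∑ d ∈ Finset.range (D + 1), ψ i d = φ i := by
    intro i
    refine b.ext fun j => ?_
    rw [LinearMap.sum_apply]
    conv_rhs => rw [← sum_homogeneousComponent (φ i (b j))]
    symm
    refine Finset.sum_subset ?_ ?_
    · intro d hd
      have := hD i j
      simp only [Finset.mem_range] at hd ⊢
      omega
    · intro d _ hd
      simp only [Finset.mem_range] at hd
      exact homogeneousComponent_eq_zero _ _ (by omega)
  let L : List (ℕ × (BinPoly ⊗[ℂ] A →ₗ[ℂ] BinPoly)) :=
    ((Finset.univ : Finset (Fin (Module.finrank ℂ A))) ×ˢ Finset.range (D + 1)).toList.map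
      fun id => (id.2, extendMap (ψ id.1 id.2))
  have hL : ∀ {F}, F ∈ L → ∃ i d, F = (d, extendMap (ψ i d)) := by
    intro F hF
    obtain ⟨⟨i, d⟩, -, rfl⟩ := List.mem_map.mp hF
    exact ⟨i, d, rfl⟩
  obtain ⟨n₀, h⟩ := eventually_subCls_mem_of_maps π ((polyRep π).tprod ρ) L
    (by
      intro F hF i t
      obtain ⟨i, d, rfl⟩ := hL hF
      exact extendMap_smul _ _ _)
    (by
      intro F hF g t
      obtain ⟨i, d, rfl⟩ := hL hF
      exact extendMap_equivariant π ρ (hψG i d) g t)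
    (tensorForms A)
    (by
      intro n t ht i
      refine tensorForms_induction (P := fun t => (X i : BinPoly) • t ∈ tensorForms A (n + 1))
        ?_ ?_ ?_ ht
      · rw [smul_zero]; exact zero_mem _
      · intro s t hs ht
        rw [smul_add]; exact add_mem hs ht
      · intro p hp a
        rw [smul_tmul', smul_eq_mul, mul_comm]
        exact tmul_mem_tensorForms (IsHomogeneous.mul hp (isHomogeneous_X ℂ i)) a)
    (tensorForms_stable π ρ)
    (by
      intro F hF n t ht
      obtain ⟨i, d, rfl⟩ := hL hF
      refine tensorForms_induction (P := fun t => extendMap (ψ i d) t ∈ binForms (n + d))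
        ?_ ?_ ?_ ht
      · rw [map_zero]; exact zero_mem _
      · intro s t hs ht
        rw [map_add]; exact add_mem hs ht
      · intro p hp a
        exact IsHomogeneous.mul hp (homogeneousComponent_isHomogeneous d _))
    (by
      intro n t _ h0
      have hi : ∀ i, extendMap (φ i) t = 0 := by
        intro i
        rw [← hψsum, extendMap_sum]
        refine Finset.sum_eq_zero fun d hd => h0 _ (List.mem_map.mpr ⟨(i, d), ?_, rfl⟩)
        rw [Finset.mem_toList, Finset.mem_product]
        exact ⟨Finset.mem_univ _, hd⟩
      let B := b.baseChange BinPoly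
      let M : Matrix (Fin (Module.finrank ℂ A)) (Fin (Module.finrank ℂ A)) BinPoly :=
        Matrix.of fun i j => φ i (b j)
      -- At `p` the matrix specializes to the identity, so the maps `extendMap (φ i)` are jointly
      -- injective on the free module `S ⊗ A`.
      have hdet : M.det ≠ 0 := by
        intro hM
        have h1 := congrArg (eval p) hM
        rw [RingHom.map_det, map_zero] at h1
        have : (eval p).mapMatrix M = 1 := by
          ext i j
          simp [M, hφ, Matrix.one_apply, Finsupp.single_apply, eq_comm]
        rw [this, Matrix.det_one] at h1
        exact one_ne_zero h1
      have hv : M.mulVec (B.repr t) = 0 := by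
        ext1 i
        rw [Pi.zero_apply, ← hi i]
        conv_rhs => rw [← B.sum_repr t, map_sum]
        change ∑ j, φ i (b j) * B.repr t j = _
        refine Finset.sum_congr rfl fun j _ => ?_
        rw [extendMap_smul, Module.Basis.baseChange_apply, extendMap_tmul, one_mul, mul_comm]
      have hz := Matrix.eq_zero_of_mulVec_eq_zero hdet hv
      rw [← B.sum_repr t]
      exact Finset.sum_eq_zero fun j _ => by rw [congrFun hz j, Pi.zero_apply, zero_smul])
  refine ⟨n₀, fun n hn => ?_⟩
  rw [← subCls_tensorForms]
  exact h n hn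

theorem repCls_mem_charSubring [Finite G] (hπ : Function.Injective π) [FiniteDimensional ℂ A]
    (ρ : Representation ℂ G A) : repCls ρ ∈ charSubring π := by
  let χ : G →* ℂ :=
    { toFun := fun g => (detChar π g)⁻¹
      map_one' := by simp
      map_mul' := fun g h => by rw [map_mul, mul_inv] }
  have hχ : χ * detChar π = 1 := by
    ext g
    have h : detChar π g * detChar π g⁻¹ = 1 := by rw [← map_mul, mul_inv_cancel, map_one]
    exact inv_mul_cancel₀ (left_ne_zero_of_mul_eq_one h)
  have hinv : repCls (charRep χ) * repCls (charRep (detChar π)) = 1 := by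
    rw [repCls_charRep_mul, hχ, repCls_charRep_one]
  -- The Koszul recursion read downwards, possible because `[det]` has the inverse `[χ]`.
  have hstep : ∀ n, repCls (symRep π (n + 1)) * repCls ρ ∈ charSubring π →
      repCls (symRep π (n + 2)) * repCls ρ ∈ charSubring π →
      repCls (symRep π n) * repCls ρ ∈ charSubring π := by
    intro n h1 h2
    have : repCls (symRep π n) * repCls ρ = repCls (charRep χ) *
        (repCls (stdRep π) * (repCls (symRep π (n + 1)) * repCls ρ) -
          repCls (symRep π (n + 2)) * repCls ρ) := by
      linear_combination (-(repCls (symRep π n) * repCls ρ)) * hinv -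
        repCls (charRep χ) * repCls ρ * koszul_repCls π n
    rw [this]
    exact mul_mem (charRep_mem π χ) (sub_mem (mul_mem (stdRep_mem π) h1) h2)
  obtain ⟨n₀, h⟩ := eventually_symRep_mul_mem π hπ ρ
  have hall : ∀ k n, n₀ ≤ n + k → repCls (symRep π n) * repCls ρ ∈ charSubring π := by
    intro k
    induction k with
    | zero => exact fun n hn => h n hn
    | succ k ih => exact fun n hn => hstep n (ih _ (by omega)) (ih _ (by omega))
  have := hall n₀ 0 (by omega)
  rwa [repCls_symRep_zero, one_mul] at this

end Embedding

/-! ### Conclusion -/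

theorem subring_eq_top_of_repClass_mem {G : Type*} [Group G] {S : Subring (RepRing G)}
    (h : ∀ A : FDRep ℂ G, repClass A ∈ S) : S = ⊤ := by
  rw [eq_top_iff]
  rintro x -
  obtain ⟨x, rfl⟩ := Ideal.Quotient.mk_surjective x
  induction x using MonoidAlgebra.induction_on with
  | of s =>
    obtain ⟨A, rfl⟩ := Quotient.exists_rep s
    exact h A
  | add x y hx hy => rw [map_add]; exact add_mem hx hy
  | smul r x hx => rw [map_zsmul]; exact zsmul_mem hx r

theorem mainTheorem8 {V : Type*} [AddCommGroup V] [Module ℂ V] (hV : Module.finrank ℂ V = 2)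
    (W : Subgroup (V ≃ₗ[ℂ] V)) (hW : IsReflectionGroup W)
    (hirr : (reflectionRep W).IsIrreducible) :
    Subring.closure
      ({x : RepRing W | ∃ A : FDRep ℂ W,
          Nonempty (Representation.Equiv A.ρ (reflectionRep W)) ∧ x = repClass A} ∪
        {x : RepRing W | ∃ A : FDRep ℂ W, Module.finrank ℂ A = 1 ∧ x = repClass A}) = ⊤ := by
  have : Finite W := hW.finite
  have : FiniteDimensional ℂ V := Module.finite_of_finrank_pos (by omega)
  let b : Module.Basis (Fin 2) ℂ V := Module.finBasisOfFinrankEq ℂ V hV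
  let π : W →* Matrix (Fin 2) (Fin 2) ℂ :=
    (LinearMap.toMatrixAlgEquiv b).toMonoidHom.comp (reflectionRep W)
  have hπ : Function.Injective π := by
    intro g h hgh
    have h1 := (LinearMap.toMatrixAlgEquiv b).injective hgh
    exact Subtype.ext (LinearEquiv.ext fun v => LinearMap.congr_fun h1 v)
  refine subring_eq_top_of_repClass_mem fun A => ?_
  have hA : repClass A ∈ charSubring π := repCls_mem_charSubring π hπ A.ρ
  refine Subring.closure_mono ?_ hA
  rintro x (rfl | ⟨χ, rfl⟩)
  -- `V` may live in any universe, so its class is represented by the coordinate model on `Fin 2 →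
  -- ℂ`.
  · refine Or.inl ⟨FDRep.of (stdRep π), ⟨?_⟩, rfl⟩
    refine Representation.Equiv.mk b.equivFun.symm fun g => ?_
    refine LinearMap.ext fun v => ?_
    change b.equivFun.symm ((LinearMap.toMatrixAlgEquiv b (reflectionRep W g)).mulVec v) =
      reflectionRep W g (b.equivFun.symm v)
    apply b.equivFun.injective
    rw [LinearEquiv.apply_symm_apply]
    have h := LinearMap.toMatrix_mulVec_repr b b (reflectionRep W g) (b.equivFun.symm v)
    rwa [← Module.Basis.equivFun_apply, ← Module.Basis.equivFun_apply,
      LinearEquiv.apply_symm_apply] at h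
  · exact Or.inr ⟨FDRep.of (charRep χ), Module.finrank_self ℂ, rfl⟩

end
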